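/- For an odd prime $p$ let $$T(p)=\sqrt{p}\sum_{n=1}^{(p-1)/2}\tan\frac{\pi n^2}{p}.$$ Let $p$ be a prime. If $p\equiv 3\pmod 8$, then $T(p)>0$, and in the set $\{1,2,\dots,p-1\}$ the number of odd quadratic residues modulo $p$ is strictly greater than the number of even quadratic residues modulo $p$. If $p\equiv 7\pmod 8$, then $T(p)<0$, and in the set $\{1,2,\dots,p-1\}$ the number of even quadratic residues modulo $p$ is strictly greater than the number of odd quadratic residues modulo $p$. -/

import Mathlib

/-- `T(p) = √p · ∑_{n=1}^{(p-1)/2} tan (π n² / p)`. -/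
noncomputable def tanSum (p : ℕ) : ℝ :=
  Real.sqrt p * ∑ n ∈ Finset.Icc 1 ((p - 1) / 2), Real.tan (Real.pi * (n : ℝ) ^ 2 / p)

/-- `k` is a quadratic residue modulo `p`: its class is nonzero and a square. -/
def IsQuadraticResidue (p k : ℕ) : Prop :=
  (k : ZMod p) ≠ 0 ∧ IsSquare (k : ZMod p)

/-- The set of odd quadratic residues modulo `p` in `{1, …, p - 1}`. -/
def oddResidues (p : ℕ) : Set ℕ :=
  {k | k ∈ Set.Icc 1 (p - 1) ∧ Odd k ∧ IsQuadraticResidue p k}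

/-- The set of even quadratic residues modulo `p` in `{1, …, p - 1}`. -/
def evenResidues (p : ℕ) : Set ℕ :=
  {k | k ∈ Set.Icc 1 (p - 1) ∧ Even k ∧ IsQuadraticResidue p k}

/-!
The Gauss sum of the Legendre symbol `χ` modulo `p ≡ 3 (mod 4)` is `i √p`. Expanding
`1 - i tan (π a / p) = ∑ⱼ (-1)ʲ e^{2πi aj/p}` and summing against `χ` therefore turns `T(p)` into
`-p D / 2`, where `D = ∑ (-1)ᵃ χ(a)` over `0 ≤ a < p`. Since `χ(p - a) = -χ(a)` while `a` and
`p - a` have opposite parities, `D / 2` is also the number of even residues minus the number of odd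
ones. The substitution `a ↦ 2a` gives `p D = 2 (1 - 2 χ(2)) A` with `A = ∑ a χ(a)`, so everything
follows from `A < 0` and the value of `χ(2)`.

The inequality `A < 0` is the class number formula `√p L(1, χ) = -(π / p) A` together with
`L(1, χ) > 0`. The latter holds because the Euler product is nonnegative for `s > 1` and
`L(1, χ) ≠ 0`. The former rests on `∑ sin (2πnx) / n = π (1/2 - x)`: the series converges only
conditionally, so its value is read off at `s = 1` from the Mellin transform
`Γ(s) ∑ zⁿ / nˢ = ∫ t^{s-1} z e^{-t} / (1 - z e^{-t}) dt`, which is analytic for `Re s > 0`.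

For the sign of the Gauss sum `G`, put `m = (p - 1) / 2` and `η = -e^{πi/p}`, whose square is
`e^{2πi/p}`. Both `χ(2) G = ∑ χ(a) ηᵃ` and `P = ∏ (ηᵏ - η⁻ᵏ)` over `1 ≤ k ≤ m` square to `-p`, so
they differ by a sign `ε`, and `P = -i √p` because it is a product of positive sines up to powers
of `i`. Modulo `p` the cyclotomic polynomial is `(X - 1)^{p-1}`, so the relation can be compared at
`(X - 1)^m`: this yields `ε χ(2) (m!)² ≡ -1`, whence `ε = -χ(2)` as `-1` is not a square modulo
`p`.
-/

open Finset

section GaussSumSign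

open Polynomial

theorem sum_eval_of_monic_of_natDegree_eq_card_sub_one {K : Type*} [Field K] [Fintype K] {Q : K[X]}
    (hQ : Q.Monic) (hdeg : Q.natDegree = Fintype.card K - 1) : ∑ x, Q.eval x = -1 := by
  classical
  have sum_pow_card_sub_one : ∑ x : K, x ^ (Fintype.card K - 1) = -1 := by
    have hpow (x : K) : x ^ (Fintype.card K - 1) = 1 - if x = 0 then 1 else 0 := by
      rcases eq_or_ne x 0 with rfl | hx
      · simp [zero_pow (Nat.sub_ne_zero_of_lt (Fintype.one_lt_card (α := K)))]
      · simp [FiniteField.pow_card_sub_one_eq_one x hx, hx]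
    simp [hpow]
  have hlead : Q.coeff (Fintype.card K - 1) = 1 := hdeg ▸ hQ
  simp_rw [eval_eq_sum_range, hdeg]
  rw [sum_comm, sum_range_succ, ← mul_sum, hlead, sum_pow_card_sub_one, one_mul, add_eq_right]
  refine sum_eq_zero fun i hi ↦ ?_
  rw [← mul_sum, FiniteField.sum_pow_lt_card_sub_one K i (mem_range.1 hi), mul_zero]

theorem sum_pow_mul_choose_val {p m : ℕ} [Fact p.Prime] (hpm : p = 2 * m + 1) :
    (∑ a : ZMod p, a ^ m * (a.val.choose m : ZMod p)) * (m.factorial : ZMod p) = -1 := by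
  have hmonic : (X ^ m * descPochhammer (ZMod p) m).Monic :=
    (monic_X_pow m).mul (monic_descPochhammer _ m)
  have hdeg : (X ^ m * descPochhammer (ZMod p) m).natDegree = Fintype.card (ZMod p) - 1 := by
    rw [(monic_X_pow m).natDegree_mul (monic_descPochhammer _ m), natDegree_X_pow,
      descPochhammer_natDegree, ZMod.card]
    lia
  rw [← sum_eval_of_monic_of_natDegree_eq_card_sub_one hmonic hdeg, sum_mul]
  refine sum_congr rfl fun a _ ↦ ?_
  have heval : (descPochhammer (ZMod p) m).eval a = (a.val.descFactorial m : ZMod p) := by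
    rw [← descPochhammer_eval_eq_descFactorial, ZMod.natCast_zmod_val]
  rw [eval_mul, eval_pow, eval_X, heval, Nat.descFactorial_eq_factorial_mul_choose]
  push_cast
  ring

/-- Modulo `p` the cyclotomic polynomial `Φ_p` is `(X - 1) ^ (p - 1)`. -/
theorem coeff_taylor_one_map_of_aeval_eq_zero {p : ℕ} [Fact p.Prime] {K : Type*} [Field K]
    [CharZero K] {η : K} (hη : IsPrimitiveRoot η p) {f : ℤ[X]} (hf : aeval η f = 0) {k : ℕ}
    (hk : k < p - 1) : (taylor 1 (f.map (Int.castRingHom (ZMod p)))).coeff k = 0 := by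
  have hp : p.Prime := Fact.out
  have hdvd : cyclotomic p ℤ ∣ f := by
    rw [cyclotomic_eq_minpoly hη hp.pos]
    exact minpoly.isIntegrallyClosed_dvd (hη.isIntegral hp.pos) hf
  have hmod : cyclotomic p (ZMod p) = (X - 1) ^ (p - 1) := by
    simpa using cyclotomic_mul_prime_eq_pow_of_not_dvd (ZMod p) (p := p) (n := 1)
      (by simpa using hp.one_lt.ne')
  obtain ⟨g, rfl⟩ := hdvd
  rw [Polynomial.map_mul, map_cyclotomic, hmod, taylor_mul, taylor_pow, map_sub, taylor_X,
    taylor_one, C_1, add_sub_cancel_right, coeff_X_pow_mul', if_neg (by lia)]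

theorem coeff_prod_of_X_dvd {R ι : Type*} [CommRing R] (s : Finset ι) (f : ι → R[X])
    (hf : ∀ i ∈ s, X ∣ f i) : (∏ i ∈ s, f i).coeff #s = ∏ i ∈ s, (f i).coeff 1 := by
  have hX : ∀ i ∈ s, f i = X * divX (f i) := fun i hi ↦ by
    have := divX_mul_X_add (f i)
    rw [X_dvd_iff.1 (hf i hi), C_0, add_zero, mul_comm] at this
    exact this.symm
  have hcoeff := coeff_X_pow_mul (∏ i ∈ s, divX (f i)) #s 0
  rw [zero_add, coeff_zero_prod] at hcoeff
  rw [prod_congr rfl hX, prod_mul_distrib, prod_const, hcoeff]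
  exact prod_congr rfl fun i _ ↦ coeff_divX

theorem coeff_taylor_one_prod_X_pow_sub_X_pow {R : Type*} [CommRing R] {p m : ℕ} [CharP R p]
    (hm : m ≤ p) :
    (taylor 1 (∏ k ∈ range m, (X ^ (k + 1) - X ^ (p - (k + 1)) : R[X]))).coeff m =
      2 ^ m * (m.factorial : R) := by
  have hdvd : ∀ k ∈ range m, (X : R[X]) ∣ taylor 1 (X ^ (k + 1) - X ^ (p - (k + 1))) := by
    simp [X_dvd_iff, coeff_X_add_one_pow]
  have hcoeff : ∀ k ∈ range m,
      (taylor 1 (X ^ (k + 1) - X ^ (p - (k + 1)) : R[X])).coeff 1 = 2 * ((k + 1 : ℕ) : R) := by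
    intro k hk
    have hkp : k + 1 ≤ p := by grind
    simp [coeff_X_add_one_pow, Nat.cast_sub hkp]
    ring
  have hprod : taylor 1 (∏ k ∈ range m, (X ^ (k + 1) - X ^ (p - (k + 1)) : R[X])) =
      ∏ k ∈ range m, taylor 1 (X ^ (k + 1) - X ^ (p - (k + 1))) := map_prod (taylorAlgHom 1) _ _
  have hlow := coeff_prod_of_X_dvd _ _ hdvd
  rw [card_range] at hlow
  rw [hprod, hlow, prod_congr rfl hcoeff, prod_mul_distrib, prod_const, card_range,
    ← prod_range_add_one_eq_factorial, Nat.cast_prod]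

theorem prod_pow_sub_pow_sub_sq {R : Type*} [CommRing R] [IsDomain R] {p m : ℕ}
    (hpm : p = 2 * m + 1) {η : R} (hη : IsPrimitiveRoot η p) :
    (∏ k ∈ range m, (η ^ (k + 1) - η ^ (p - (k + 1)))) ^ 2 = (-1) ^ m * p := by
  subst hpm
  have hη2 : IsPrimitiveRoot (η ^ 2) (2 * m + 1) := hη.pow_of_coprime 2 (by simp)
  have hfactor : ∀ k ∈ range m, (η ^ (k + 1) - η ^ (2 * m + 1 - (k + 1))) ^ 2 =
      -1 * ((1 - (η ^ 2) ^ (k + 1)) * (1 - (η ^ 2) ^ (2 * m + 1 - (k + 1)))) := by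
    intro k hk
    have hinv : η ^ (k + 1) * η ^ (2 * m + 1 - (k + 1)) = 1 := by
      rw [← pow_add, Nat.add_sub_cancel' (by grind), hη.pow_eq_one]
    rw [pow_right_comm η 2 (k + 1), pow_right_comm η 2 (2 * m + 1 - (k + 1))]
    linear_combination (η ^ (k + 1) * η ^ (2 * m + 1 - (k + 1)) - 1) * hinv
  have hreflect : ∏ k ∈ range m, (1 - (η ^ 2) ^ (2 * m + 1 - (k + 1))) =
      ∏ k ∈ range m, (1 - (η ^ 2) ^ (m + k + 1)) := by
    rw [← prod_range_reflect]
    refine prod_congr rfl fun k hk ↦ ?_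
    congr 2
    grind
  rw [← prod_pow, prod_congr rfl hfactor, prod_mul_distrib, prod_const, card_range,
    prod_mul_distrib, hreflect, ← prod_range_add (fun k ↦ 1 - (η ^ 2) ^ (k + 1)), ← two_mul,
    hη2.prod_one_sub_pow_eq_order]
  push_cast
  rfl

theorem isPrimitiveRoot_stdAddChar {p : ℕ} [Fact p.Prime] {a : ZMod p} (ha : a ≠ 0) :
    IsPrimitiveRoot (ZMod.stdAddChar a) p := by
  rw [IsPrimitiveRoot.iff_orderOf]
  refine orderOf_eq_prime (by simp [← AddChar.map_nsmul_eq_pow]) fun h ↦ ha ?_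
  rw [← (ZMod.stdAddChar (N := p)).map_zero_eq_one] at h
  exact ZMod.injective_stdAddChar h

theorem ringChar_zmod_ne_two_of_odd {p : ℕ} (hp : Odd p) : ringChar (ZMod p) ≠ 2 := by
  rw [ZMod.ringChar_zmod_n]
  exact hp.ne_two_of_dvd_nat dvd_rfl

theorem two_ne_zero_of_odd_prime {p : ℕ} [Fact p.Prime] (hp : Odd p) : (2 : ZMod p) ≠ 0 :=
  Ring.two_ne_zero (ringChar_zmod_ne_two_of_odd hp)

theorem stdAddChar_two_inv {p : ℕ} [Fact p.Prime] (hp : Odd p) :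
    ZMod.stdAddChar (2⁻¹ : ZMod p) = -Complex.exp (Real.pi * Complex.I / p) := by
  obtain ⟨m, hpm⟩ := hp
  have hp0 : (p : ℂ) ≠ 0 := Nat.cast_ne_zero.2 (NeZero.ne p)
  have hinv : (2⁻¹ : ZMod p) = ((m + 1 : ℤ) : ZMod p) := by
    have hmod : (2 * m + 1 : ZMod p) = 0 := by
      exact_mod_cast (hpm ▸ ZMod.natCast_self p : ((2 * m + 1 : ℕ) : ZMod p) = 0)
    rw [inv_eq_iff_eq_inv, eq_comm]
    refine inv_eq_of_mul_eq_one_left ?_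
    push_cast
    linear_combination hmod
  have harg : 2 * Real.pi * Complex.I * ((m + 1 : ℤ) : ℂ) / p =
      Real.pi * Complex.I + Real.pi * Complex.I / p := by
    field_simp
    rw [hpm]
    push_cast
    ring
  rw [hinv, ZMod.stdAddChar_coe, harg, Complex.exp_add, Complex.exp_pi_mul_I, neg_one_mul]

theorem stdAddChar_two_inv_pow_sub {p : ℕ} [Fact p.Prime] (hp : Odd p) {j : ℕ} (hj : j ≤ p) :
    ZMod.stdAddChar (2⁻¹ : ZMod p) ^ j - ZMod.stdAddChar (2⁻¹ : ZMod p) ^ (p - j) =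
      Complex.I * (-1) ^ j * (2 * Real.sin (Real.pi * j / p) : ℝ) := by
  have hroot : ZMod.stdAddChar (2⁻¹ : ZMod p) ^ p = 1 := by simp [← AddChar.map_nsmul_eq_pow]
  have hne : ZMod.stdAddChar (2⁻¹ : ZMod p) ≠ 0 := by simp [stdAddChar_two_inv hp]
  have hpow : ZMod.stdAddChar (2⁻¹ : ZMod p) ^ j =
      (-1) ^ j * Complex.exp (Real.pi * j / p * Complex.I) := by
    rw [stdAddChar_two_inv hp, neg_pow, ← Complex.exp_nat_mul]
    ring_nf
  have hsign : ((-1 : ℂ) ^ j)⁻¹ = (-1) ^ j := by rw [← inv_pow, inv_neg, inv_one]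
  rw [pow_sub₀ _ hne hj, hroot, one_mul, hpow, mul_inv, hsign, ← Complex.exp_neg, ← neg_mul]
  push_cast
  rw [Complex.two_sin]
  linear_combination (-1) ^ j * (Complex.exp (Real.pi * j / p * Complex.I) -
    Complex.exp (-(Real.pi * j / p) * Complex.I)) * Complex.I_mul_I

theorem prod_I_mul_neg_one_pow {m : ℕ} (hm : Odd m) :
    ∏ k ∈ range m, Complex.I * (-1) ^ (k + 1) = -Complex.I := by
  obtain ⟨t, rfl⟩ := hm
  induction t with
  | zero => simp
  | succ t ih =>
    rw [show 2 * (t + 1) + 1 = 2 * t + 1 + 1 + 1 by ring, prod_range_succ, prod_range_succ, ih]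
    have hsign : ((-1 : ℂ) ^ t) ^ 2 = 1 := by rw [← pow_mul, mul_comm, pow_mul, neg_one_sq, one_pow]
    linear_combination ((-1 : ℂ) ^ t) ^ 4 * Complex.I * Complex.I_mul_I -
      Complex.I * (((-1 : ℂ) ^ t) ^ 2 + 1) * hsign

theorem prod_stdAddChar_two_inv_pow_sub {p m : ℕ} [Fact p.Prime] (hpm : p = 2 * m + 1)
    (hm : Odd m) :
    ∏ k ∈ range m, (ZMod.stdAddChar (2⁻¹ : ZMod p) ^ (k + 1) -
      ZMod.stdAddChar (2⁻¹ : ZMod p) ^ (p - (k + 1))) = -Complex.I * Real.sqrt p := by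
  have hp : Odd p := ⟨m, hpm⟩
  set c : ℝ := ∏ k ∈ range m, 2 * Real.sin (Real.pi * (k + 1 : ℕ) / p)
  have hc : 0 < c := by
    refine prod_pos fun k hk ↦ mul_pos two_pos ?_
    have hp0 : (0 : ℝ) < p := Nat.cast_pos.2 (NeZero.pos p)
    refine Real.sin_pos_of_pos_of_lt_pi (by positivity) ?_
    rw [div_lt_iff₀ hp0]
    gcongr
    grind
  have hprod : ∏ k ∈ range m, (ZMod.stdAddChar (2⁻¹ : ZMod p) ^ (k + 1) -
      ZMod.stdAddChar (2⁻¹ : ZMod p) ^ (p - (k + 1))) = -Complex.I * c := by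
    rw [prod_congr rfl fun k hk ↦ stdAddChar_two_inv_pow_sub hp (j := k + 1) (by grind),
      prod_mul_distrib, prod_I_mul_neg_one_pow hm, Complex.ofReal_prod]
  have hsq : (c : ℂ) ^ 2 = p := by
    have := prod_pow_sub_pow_sub_sq hpm
      (isPrimitiveRoot_stdAddChar (inv_ne_zero (two_ne_zero_of_odd_prime hp)))
    rw [hprod, hm.neg_one_pow] at this
    linear_combination -this - (c : ℂ) ^ 2 * (-1) * Complex.I_sq
  have hcp : c = Real.sqrt p := by
    rw [← Real.sqrt_sq hc.le]
    exact congrArg Real.sqrt (mod_cast hsq)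
  rw [hprod, hcp]

theorem intCast_quadraticChar_eq_pow {p m : ℕ} [Fact p.Prime] (hpm : p = 2 * m + 1) (a : ZMod p) :
    ((quadraticChar (ZMod p) a : ℤ) : ZMod p) = a ^ m := by
  rw [quadraticChar_eq_pow_of_char_ne_two' (ringChar_zmod_ne_two_of_odd ⟨m, hpm⟩), ZMod.card]
  congr
  lia

/-- Compare the coefficients of `(X - 1) ^ m` on both sides modulo `p` and multiply by `m!`. -/
theorem mul_quadraticChar_two_mul_factorial_sq {p m : ℕ} [Fact p.Prime] (hpm : p = 2 * m + 1)
    {K : Type*} [Field K] [CharZero K] {η : K} (hη : IsPrimitiveRoot η p) {ε : ℤ}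
    (h : ∑ a : ZMod p, (quadraticChar (ZMod p) a : K) * η ^ a.val =
      ε * ∏ k ∈ range m, (η ^ (k + 1) - η ^ (p - (k + 1)))) :
    ((ε * quadraticChar (ZMod p) 2 : ℤ) : ZMod p) * (m.factorial : ZMod p) ^ 2 = -1 := by
  set F : ℤ[X] := ∑ a : ZMod p, C (quadraticChar (ZMod p) a) * X ^ a.val
  set P : ℤ[X] := ∏ k ∈ range m, (X ^ (k + 1) - X ^ (p - (k + 1))) with hP
  have hroot : aeval η (F - C ε * P) = 0 := by
    simpa [F, P, sub_eq_zero] using h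
  have hF : (taylor 1 (F.map (Int.castRingHom (ZMod p)))).coeff m =
      ∑ a : ZMod p, a ^ m * (a.val.choose m : ZMod p) := by
    simp only [F, Polynomial.map_sum, Polynomial.map_mul, Polynomial.map_pow, map_C, map_X, map_sum,
      taylor_mul, taylor_C, taylor_pow, taylor_X, C_1, finsetSum_coeff, coeff_C_mul,
      coeff_X_add_one_pow]
    simp only [eq_intCast, intCast_quadraticChar_eq_pow hpm]
  have hPcoeff : (taylor 1 (P.map (Int.castRingHom (ZMod p)))).coeff m =
      2 ^ m * (m.factorial : ZMod p) := by
    rw [← coeff_taylor_one_prod_X_pow_sub_X_pow (p := p) (by lia), hP, Polynomial.map_prod]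
    simp
  have hmp : m < p - 1 := by
    have := (Fact.out : p.Prime).two_le
    lia
  have hcongr : ∑ a : ZMod p, a ^ m * (a.val.choose m : ZMod p) =
      ε * (2 ^ m * (m.factorial : ZMod p)) := by
    have hcoeff := coeff_taylor_one_map_of_aeval_eq_zero hη hroot hmp
    rwa [Polynomial.map_sub, Polynomial.map_mul, map_C, map_sub, taylor_mul, taylor_C, coeff_sub,
      coeff_C_mul, hF, hPcoeff, sub_eq_zero] at hcoeff
  rw [Int.cast_mul, intCast_quadraticChar_eq_pow hpm, ← sum_pow_mul_choose_val hpm, hcongr]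
  ring

theorem eq_neg_quadraticChar_two {p m : ℕ} [Fact p.Prime] (hpm : p = 2 * m + 1) (hm : Odd m)
    {K : Type*} [Field K] [CharZero K] {η : K} (hη : IsPrimitiveRoot η p) {ε : ℤ}
    (hε : ε = 1 ∨ ε = -1)
    (h : ∑ a : ZMod p, (quadraticChar (ZMod p) a : K) * η ^ a.val =
      ε * ∏ k ∈ range m, (η ^ (k + 1) - η ^ (p - (k + 1)))) :
    ε = -quadraticChar (ZMod p) 2 := by
  have hcongr := mul_quadraticChar_two_mul_factorial_sq hpm hη h
  have hnonsquare : ¬ IsSquare (-1 : ZMod p) := by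
    rw [ZMod.exists_sq_eq_neg_one_iff]
    grind
  have hne : ε * quadraticChar (ZMod p) 2 ≠ 1 := fun h ↦ by
    rw [h, Int.cast_one, one_mul] at hcongr
    exact hnonsquare (hcongr ▸ IsSquare.sq _)
  have h2 : (2 : ZMod p) ≠ 0 := two_ne_zero_of_odd_prime ⟨m, hpm⟩
  rcases hε with rfl | rfl <;> rcases quadraticChar_dichotomy h2 with h | h <;> simp_all

/-- The quadratic character modulo the prime `p`, with values in `ℂ` so that Mathlib's theory of
Gauss sums and of Dirichlet `L`-functions applies to it. -/
noncomputable def quadraticDirichletChar (p : ℕ) [Fact p.Prime] : DirichletCharacter ℂ p :=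
  (quadraticChar (ZMod p)).ringHomComp (Int.castRingHom ℂ)

theorem quadraticDirichletChar_apply {p : ℕ} [Fact p.Prime] (a : ZMod p) :
    quadraticDirichletChar p a = (quadraticChar (ZMod p) a : ℂ) :=
  rfl

theorem quadraticDirichletChar_isQuadratic (p : ℕ) [Fact p.Prime] :
    (quadraticDirichletChar p).IsQuadratic :=
  (quadraticChar_isQuadratic (ZMod p)).comp _

theorem quadraticDirichletChar_ne_one {p : ℕ} [Fact p.Prime] (hp : Odd p) :
    quadraticDirichletChar p ≠ 1 := by
  rw [quadraticDirichletChar, ne_eq, MulChar.ringHomComp_eq_one_iff (RingHom.injective_int _)]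
  exact quadraticChar_ne_one (ringChar_zmod_ne_two_of_odd hp)

theorem quadraticDirichletChar_neg_one {p : ℕ} [Fact p.Prime] (hp : p % 4 = 3) :
    quadraticDirichletChar p (-1) = -1 := by
  have hchar : ringChar (ZMod p) ≠ 2 := by rw [ZMod.ringChar_zmod_n]; lia
  rw [quadraticDirichletChar_apply, quadraticChar_neg_one hchar, ZMod.card,
    ZMod.χ₄_nat_three_mod_four hp]
  simp

theorem isPrimitive_of_prime_of_ne_one {R : Type*} [CommMonoidWithZero R] {p : ℕ} [Fact p.Prime]
    {χ : DirichletCharacter R p} (hχ : χ ≠ 1) : χ.IsPrimitive := by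
  rcases (Fact.out : p.Prime).eq_one_or_self_of_dvd _ χ.conductor_dvd_level with h | h
  · exact absurd ((DirichletCharacter.eq_one_iff_conductor_eq_one).2 h) hχ
  · exact h

theorem sum_quadraticDirichletChar_mul_stdAddChar {p : ℕ} [Fact p.Prime] (hp : Odd p)
    (b : ZMod p) : ∑ a : ZMod p, quadraticDirichletChar p a * ZMod.stdAddChar (b * a) =
      quadraticDirichletChar p b * gaussSum (quadraticDirichletChar p) ZMod.stdAddChar := by
  have hprim := isPrimitive_of_prime_of_ne_one (quadraticDirichletChar_ne_one hp)
  have hshift := gaussSum_mulShift_of_isPrimitive ZMod.stdAddChar hprim b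
  rwa [(quadraticDirichletChar_isQuadratic p).inv] at hshift

theorem gaussSum_quadraticDirichletChar_sq {p : ℕ} [Fact p.Prime] (hp : p % 4 = 3) :
    gaussSum (quadraticDirichletChar p) ZMod.stdAddChar ^ 2 = -p := by
  have hne : quadraticDirichletChar p ≠ 1 := quadraticDirichletChar_ne_one (by grind)
  rw [gaussSum_sq hne (quadraticDirichletChar_isQuadratic p) (ZMod.isPrimitive_stdAddChar p),
    ZMod.card, quadraticDirichletChar_neg_one hp, neg_one_mul]

theorem gaussSum_quadraticDirichletChar {p : ℕ} [Fact p.Prime] (hp : p % 4 = 3) :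
    gaussSum (quadraticDirichletChar p) ZMod.stdAddChar = Complex.I * Real.sqrt p := by
  obtain ⟨m, hpm⟩ : ∃ m, p = 2 * m + 1 := ⟨p / 2, by lia⟩
  have hodd : Odd p := ⟨m, hpm⟩
  have hm : Odd m := by grind
  have h2 : (2 : ZMod p) ≠ 0 := two_ne_zero_of_odd_prime hodd
  set χ := quadraticDirichletChar p
  set G := gaussSum χ ZMod.stdAddChar
  set η := ZMod.stdAddChar (2⁻¹ : ZMod p)
  set P := ∏ k ∈ range m, (η ^ (k + 1) - η ^ (p - (k + 1)))
  have hP : P = -Complex.I * Real.sqrt p := prod_stdAddChar_two_inv_pow_sub hpm hm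
  have hχ2 : χ 2 ^ 2 = 1 := by
    rw [quadraticDirichletChar_apply]
    exact_mod_cast quadraticChar_sq_one h2
  have hsum : ∑ a : ZMod p, χ a * η ^ a.val = χ 2 * G := by
    have hinv : χ 2⁻¹ = χ 2 := by
      rw [← MulChar.inv_apply', (quadraticDirichletChar_isQuadratic p).inv]
    rw [← hinv, ← sum_quadraticDirichletChar_mul_stdAddChar hodd]
    refine sum_congr rfl fun a _ ↦ ?_
    rw [← AddChar.map_nsmul_eq_pow, nsmul_eq_mul, ZMod.natCast_zmod_val, mul_comm a]
  have hsq : (χ 2 * G) ^ 2 = P ^ 2 := by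
    rw [mul_pow, hχ2, gaussSum_quadraticDirichletChar_sq hp,
      prod_pow_sub_pow_sub_sq hpm (isPrimitiveRoot_stdAddChar (inv_ne_zero h2)), hm.neg_one_pow]
    ring
  obtain ⟨ε, hε, hεG⟩ : ∃ ε : ℤ, (ε = 1 ∨ ε = -1) ∧ χ 2 * G = ε * P := by
    rcases sq_eq_sq_iff_eq_or_eq_neg.1 hsq with h | h
    exacts [⟨1, .inl rfl, by simpa using h⟩, ⟨-1, .inr rfl, by simpa using h⟩]
  have hsign : (ε : ℂ) = -χ 2 := by
    rw [eq_neg_quadraticChar_two hpm hm (isPrimitiveRoot_stdAddChar (inv_ne_zero h2)) hε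
      (hsum.trans hεG), Int.cast_neg, quadraticDirichletChar_apply]
  rw [hsign, hP] at hεG
  linear_combination χ 2 * hεG + (Complex.I * Real.sqrt p - G) * hχ2

end GaussSumSign

section LFunctionAtOne

open Complex Filter MeasureTheory Set Topology

theorem one_sub_mem_slitPlane {w : ℂ} (hw : ‖w‖ ≤ 1) (hw1 : w ≠ 1) : 1 - w ∈ slitPlane := by
  refine mem_slitPlane_iff.2 (or_iff_not_imp_left.2 fun hre him ↦ hw1 ?_)
  simp only [sub_re, sub_im, one_re, one_im, not_lt, sub_nonpos, zero_sub, neg_eq_zero] at hre him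
  have hwre : w.re = 1 := le_antisymm ((re_le_norm w).trans hw) hre
  exact Complex.ext (by simp [hwre]) (by simp [him])

/-- The sum `∑_{n ≥ 1} zⁿ e^{-nt}`. Its Mellin transform at `s` is `Γ(s) ∑_{n ≥ 1} zⁿ / nˢ`. -/
noncomputable def geometricKernel (z : ℂ) (t : ℝ) : ℂ :=
  z * Real.exp (-t) / (1 - z * Real.exp (-t))

theorem norm_mul_exp_neg_le {z : ℂ} (hz : ‖z‖ ≤ 1) {t : ℝ} (ht : 0 ≤ t) :
    ‖z * Real.exp (-t)‖ ≤ 1 := by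
  rw [norm_mul, norm_real, Real.norm_of_nonneg (Real.exp_pos _).le]
  exact mul_le_one₀ hz (Real.exp_pos _).le (Real.exp_le_one_iff.2 (neg_nonpos.2 ht))

theorem norm_mul_exp_neg_lt {z : ℂ} (hz : ‖z‖ ≤ 1) {t : ℝ} (ht : 0 < t) :
    ‖z * Real.exp (-t)‖ < 1 := by
  rw [norm_mul, norm_real, Real.norm_of_nonneg (Real.exp_pos _).le]
  exact mul_lt_one_of_nonneg_of_lt_one_right hz (Real.exp_pos _).le
    (Real.exp_lt_one_iff.2 (neg_neg_iff_pos.2 ht))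

theorem one_sub_mul_exp_neg_mem_slitPlane {z : ℂ} (hz : ‖z‖ ≤ 1) (hz1 : z ≠ 1) {t : ℝ}
    (ht : 0 ≤ t) : 1 - z * Real.exp (-t) ∈ slitPlane := by
  refine one_sub_mem_slitPlane (norm_mul_exp_neg_le hz ht) fun h ↦ ?_
  rcases ht.eq_or_lt with rfl | ht
  · exact hz1 (by simpa using h)
  · exact (norm_mul_exp_neg_lt hz ht).ne (by rw [h, norm_one])

theorem continuousAt_geometricKernel {z : ℂ} (hz : ‖z‖ ≤ 1) (hz1 : z ≠ 1) {t : ℝ} (ht : 0 ≤ t) :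
    ContinuousAt (geometricKernel z) t :=
  ContinuousAt.div (by fun_prop) (by fun_prop)
    (slitPlane_ne_zero (one_sub_mul_exp_neg_mem_slitPlane hz hz1 ht))

theorem locallyIntegrableOn_geometricKernel {z : ℂ} (hz : ‖z‖ ≤ 1) (hz1 : z ≠ 1) :
    LocallyIntegrableOn (geometricKernel z) (Ioi 0) :=
  ContinuousOn.locallyIntegrableOn (fun _ ht ↦
    (continuousAt_geometricKernel hz hz1 (le_of_lt ht)).continuousWithinAt) measurableSet_Ioi

theorem tendsto_one_sub_mul_exp_neg_atTop (z : ℂ) :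
    Tendsto (fun t : ℝ ↦ 1 - z * Real.exp (-t)) atTop (𝓝 1) := by
  have hexp : Tendsto (fun t : ℝ ↦ (Real.exp (-t) : ℂ)) atTop (𝓝 0) := by
    exact_mod_cast (continuous_ofReal.tendsto 0).comp Real.tendsto_exp_neg_atTop_nhds_zero
  simpa using (hexp.const_mul z).const_sub 1

theorem isBigO_geometricKernel_atTop (z : ℂ) :
    geometricKernel z =O[atTop] fun t ↦ Real.exp (-1 * t) := by
  have hinv : Tendsto (fun t : ℝ ↦ z * (1 - z * Real.exp (-t))⁻¹) atTop (𝓝 z) := by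
    simpa using ((tendsto_one_sub_mul_exp_neg_atTop z).inv₀ one_ne_zero).const_mul z
  refine ((Asymptotics.isBigO_refl (fun t ↦ Real.exp (-1 * t)) atTop).smul
    (hinv.isBigO_one ℝ)).congr (fun t ↦ ?_) fun t ↦ ?_
  · rw [geometricKernel, real_smul, neg_one_mul]
    ring
  · simp

theorem isBigO_geometricKernel_zero {z : ℂ} (hz : ‖z‖ ≤ 1) (hz1 : z ≠ 1) :
    geometricKernel z =O[𝓝[>] 0] fun t ↦ t ^ (-0 : ℝ) := by
  simpa using ((continuousAt_geometricKernel hz hz1 le_rfl).tendsto.mono_left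
    nhdsWithin_le_nhds).isBigO_one ℝ

theorem differentiableAt_mellin_geometricKernel {z : ℂ} (hz : ‖z‖ ≤ 1) (hz1 : z ≠ 1) {s : ℂ}
    (hs : 0 < s.re) : DifferentiableAt ℂ (mellin (geometricKernel z)) s :=
  mellin_differentiableAt_of_isBigO_rpow_exp one_pos (locallyIntegrableOn_geometricKernel hz hz1)
    (isBigO_geometricKernel_atTop z) (isBigO_geometricKernel_zero hz hz1) hs

theorem hasSum_mellin_geometricKernel {z : ℂ} (hz : ‖z‖ ≤ 1) {s : ℂ} (hs : 1 < s.re) :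
    HasSum (fun n : ℕ ↦ Gamma s * z ^ (n + 1) / (n + 1 : ℝ) ^ s)
      (mellin (geometricKernel z) s) := by
  refine hasSum_mellin (p := fun n : ℕ ↦ (n + 1 : ℝ)) (fun n ↦ .inr (by positivity))
    (one_pos.trans hs) (fun t ht ↦ ?_) ?_
  · have hterm (n : ℕ) : z ^ (n + 1) * (Real.exp (-(n + 1 : ℝ) * t) : ℂ) =
        z * Real.exp (-t) * (z * Real.exp (-t)) ^ n := by
      rw [← pow_succ', mul_pow, ← ofReal_pow, ← Real.exp_nat_mul]
      push_cast
      ring_nf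
    simp_rw [hterm]
    exact (hasSum_geometric_of_norm_lt_one (norm_mul_exp_neg_lt hz ht)).mul_left _
  · refine .of_nonneg_of_le (fun n ↦ by positivity) (fun n ↦ ?_)
      ((summable_nat_add_iff 1).2 (Real.summable_one_div_nat_rpow.2 hs))
    rw [norm_pow, Nat.cast_succ]
    gcongr
    exact pow_le_one₀ (norm_nonneg z) hz

theorem mellin_geometricKernel_one {z : ℂ} (hz : ‖z‖ ≤ 1) (hz1 : z ≠ 1) :
    mellin (geometricKernel z) 1 = -log (1 - z) := by
  have hint : MellinConvergent (geometricKernel z) 1 :=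
    mellinConvergent_of_isBigO_rpow_exp one_pos (locallyIntegrableOn_geometricKernel hz hz1)
      (isBigO_geometricKernel_atTop z) (isBigO_geometricKernel_zero hz hz1) (by simp)
  have hderiv (t : ℝ) (ht : 0 ≤ t) :
      HasDerivAt (fun t : ℝ ↦ log (1 - z * Real.exp (-t))) (geometricKernel z t) t := by
    have hexp : HasDerivAt (fun t : ℝ ↦ 1 - z * (Real.exp (-t) : ℂ)) (z * Real.exp (-t)) t := by
      simpa using (((hasDerivAt_neg t).exp.ofReal_comp).const_mul z).const_sub 1
    exact hexp.clog_real (one_sub_mul_exp_neg_mem_slitPlane hz hz1 ht)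
  have hlim : Tendsto (fun t : ℝ ↦ log (1 - z * Real.exp (-t))) atTop (𝓝 0) := by
    simpa using (tendsto_one_sub_mul_exp_neg_atTop z).clog one_mem_slitPlane
  have hFTC := integral_Ioi_of_hasDerivAt_of_tendsto
    (hderiv 0 le_rfl).continuousAt.continuousWithinAt
    (fun t ht ↦ hderiv t (le_of_lt ht)) (by simpa [MellinConvergent] using hint) hlim
  simpa [mellin] using hFTC

theorem tendsto_comp_ofReal_nhdsGT {E : Type*} [TopologicalSpace E] {f : ℂ → E} {a : ℝ}
    (hf : ContinuousAt f a) : Tendsto (fun s : ℝ ↦ f s) (𝓝[>] a) (𝓝 (f a)) :=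
  (hf.comp continuous_ofReal.continuousAt).tendsto.mono_left nhdsWithin_le_nhds

theorem expZeta_one {x : ℝ} (hx : (x : UnitAddCircle) ≠ 0) :
    HurwitzZeta.expZeta x 1 = -log (1 - exp (2 * Real.pi * I * x)) := by
  set z := exp (2 * Real.pi * I * x)
  have hz : ‖z‖ ≤ 1 := by
    simp only [z]
    rw [show 2 * Real.pi * I * x = (2 * Real.pi * x : ℝ) * I by push_cast; ring,
      norm_exp_ofReal_mul_I]
  have hz1 : z ≠ 1 := fun h ↦ by
    obtain ⟨n, hn⟩ := exp_eq_one_iff.1 h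
    refine hx ((AddCircle.coe_eq_zero_iff 1).2 ⟨n, ?_⟩)
    rw [mul_comm, mul_left_inj' two_pi_I_ne_zero] at hn
    simpa using (ofReal_injective hn).symm
  have heq (s : ℝ) (hs : 1 < s) :
      mellin (geometricKernel z) s = Gamma s * HurwitzZeta.expZeta x s := by
    refine (hasSum_mellin_geometricKernel hz (by simpa using hs)).unique ?_
    have hsum := (hasSum_nat_add_iff' 1).2
      (HurwitzZeta.hasSum_expZeta_of_one_lt_re x (s := s) (by simpa using hs))
    have hs0 : (s : ℂ) ≠ 0 := ofReal_ne_zero.2 (by linarith)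
    simp only [sum_range_one, Nat.cast_zero, zero_cpow hs0, div_zero, sub_zero] at hsum
    convert! hsum.mul_left (Gamma s) using 2 with n
    rw [← exp_nat_mul]
    push_cast
    ring_nf
  have hmellin := tendsto_comp_ofReal_nhdsGT
    (differentiableAt_mellin_geometricKernel hz hz1 (s := (1 : ℝ)) (by simp)).continuousAt
  have hGamma : DifferentiableAt ℂ Gamma (1 : ℝ) := by
    rw [ofReal_one]
    exact hasDerivAt_Gamma_one.differentiableAt
  have hexpZeta := tendsto_comp_ofReal_nhdsGT (hGamma.mul
    (HurwitzZeta.differentiable_expZeta_of_ne_zero hx (1 : ℝ))).continuousAt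
  have := tendsto_nhds_unique hmellin
    (hexpZeta.congr' (eventually_nhdsWithin_of_forall fun s hs ↦ (heq s hs).symm))
  simp only [Pi.mul_apply, ofReal_one, mellin_geometricKernel_one hz hz1, Gamma_one,
    one_mul] at this
  exact this.symm

theorem arg_one_sub_exp_mul_I {θ : ℝ} (h0 : 0 < θ) (h1 : θ < 2 * Real.pi) :
    arg (1 - exp (θ * I)) = (θ - Real.pi) / 2 := by
  have hpolar : 1 - exp (θ * I) = (2 * Real.sin (θ / 2) : ℝ) *
      (Complex.cos ((θ - Real.pi) / 2 : ℝ) + Complex.sin ((θ - Real.pi) / 2 : ℝ) * I) := by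
    have hangle : (((θ - Real.pi) / 2 : ℝ) : ℂ) * I = θ / 2 * I + -(Real.pi / 2 * I) := by
      push_cast
      ring
    have hdouble : exp (θ * I) = exp (θ / 2 * I) ^ 2 := by
      rw [← exp_nat_mul]
      ring_nf
    have hinv : exp (-(θ / 2) * I) * exp (θ / 2 * I) = 1 := by
      rw [← exp_add, neg_mul, neg_add_cancel, exp_zero]
    rw [← exp_mul_I, hangle, exp_add, exp_neg, exp_pi_div_two_mul_I, hdouble, inv_I]
    push_cast
    rw [two_sin]
    linear_combination -hinv + (exp (-(θ / 2) * I) * exp (θ / 2 * I) - exp (θ / 2 * I) ^ 2) * I_sq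
  rw [hpolar, arg_mul_cos_add_sin_mul_I]
  · exact mul_pos two_pos (Real.sin_pos_of_pos_of_lt_pi (by linarith) (by linarith))
  · constructor <;> linarith [Real.pi_pos]

theorem sinZeta_one {x : ℝ} (h0 : 0 < x) (h1 : x < 1) :
    HurwitzZeta.sinZeta x 1 = Real.pi * (1 / 2 - x) := by
  set w := log (1 - exp (2 * Real.pi * I * x))
  have hx : (x : UnitAddCircle) ≠ 0 := by
    rw [ne_eq, AddCircle.coe_eq_zero_iff_of_mem_Ico ⟨h0.le, h1⟩]
    exact h0.ne'
  have hangle : 2 * Real.pi * I * x = (2 * Real.pi * x : ℝ) * I := by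
    push_cast
    ring
  have harg : arg (1 - exp (2 * Real.pi * I * x)) = Real.pi * (x - 1 / 2) := by
    rw [hangle, arg_one_sub_exp_mul_I (by positivity) (by nlinarith [Real.pi_pos])]
    ring
  have hneg : HurwitzZeta.expZeta (-x : ℝ) 1 = -starRingEnd ℂ w := by
    have hne : arg (1 - exp (2 * Real.pi * I * x)) ≠ Real.pi := by
      rw [harg]
      nlinarith [Real.pi_pos]
    rw [expZeta_one (by simpa using hx), ← log_conj _ hne, map_sub, map_one, ← exp_conj]
    simp [Complex.conj_ofNat]
  have hdiff : 2 * I * HurwitzZeta.sinZeta x 1 =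
      HurwitzZeta.expZeta x 1 - HurwitzZeta.expZeta (-x : ℝ) 1 := by
    simp only [HurwitzZeta.expZeta, AddCircle.coe_neg, HurwitzZeta.cosZeta_neg,
      HurwitzZeta.sinZeta_neg]
    ring
  have him : w - starRingEnd ℂ w = 2 * (Real.pi * (x - 1 / 2) : ℝ) * I := by
    rw [sub_conj, log_im, harg]
    push_cast
    ring
  rw [hneg, expZeta_one hx] at hdiff
  push_cast at him
  refine mul_left_cancel₀ (mul_ne_zero two_ne_zero I_ne_zero) ?_
  linear_combination hdiff - him

theorem LFunction_dft_of_odd {N : ℕ} [NeZero N] {Φ : ZMod N → ℂ} (hΦ : Φ.Odd) (s : ℂ) :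
    ZMod.LFunction (ZMod.dft Φ) s =
      -I * ∑ j, Φ j * HurwitzZeta.sinZeta (ZMod.toAddCircle j) s := by
  have hcos : ∑ j, Φ j * HurwitzZeta.cosZeta (ZMod.toAddCircle j) s = 0 := by
    refine (hΦ.mul_even fun j ↦ ?_).sum_eq_zero
    rw [map_neg, HurwitzZeta.cosZeta_neg]
  rw [ZMod.LFunction_dft Φ (.inl hΦ.map_zero)]
  simp only [HurwitzZeta.expZeta, map_neg, HurwitzZeta.cosZeta_neg, HurwitzZeta.sinZeta_neg,
    mul_add, sum_add_distrib, hcos, zero_add, mul_sum]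
  exact sum_congr rfl fun j _ ↦ by ring

theorem LFunction_dft_one_of_odd {N : ℕ} [NeZero N] {Φ : ZMod N → ℂ} (hΦ : Φ.Odd) :
    ZMod.LFunction (ZMod.dft Φ) 1 = Real.pi * I / N * ∑ j, Φ j * j.val := by
  have hN : (0 : ℝ) < N := Nat.cast_pos.2 (NeZero.pos N)
  have hterm (j : ZMod N) : Φ j * HurwitzZeta.sinZeta (ZMod.toAddCircle j) 1 =
      Real.pi / 2 * Φ j - Real.pi / N * (Φ j * j.val) := by
    rcases eq_or_ne j 0 with rfl | hj
    · simp [hΦ.map_zero]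
    · have hval : 0 < j.val := ZMod.val_pos.2 hj
      rw [ZMod.toAddCircle_apply, sinZeta_one (by positivity)
        ((div_lt_one hN).2 (Nat.cast_lt.2 (ZMod.val_lt j)))]
      push_cast
      ring
  rw [LFunction_dft_of_odd hΦ, sum_congr rfl fun j _ ↦ hterm j, sum_sub_distrib, ← mul_sum,
    ← mul_sum, hΦ.sum_eq_zero]
  ring

theorem LFunction_const_mul {N : ℕ} [NeZero N] (c : ℂ) (Φ : ZMod N → ℂ) (s : ℂ) :
    ZMod.LFunction (fun j ↦ c * Φ j) s = c * ZMod.LFunction Φ s := by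
  simp only [ZMod.LFunction, mul_sum]
  exact sum_congr rfl fun j _ ↦ by ring

theorem gaussSum_mul_LFunction_inv_one {N : ℕ} [NeZero N] {χ : DirichletCharacter ℂ N}
    (hprim : χ.IsPrimitive) (hodd : χ.Odd) :
    gaussSum χ ZMod.stdAddChar * χ⁻¹.LFunction 1 = -(Real.pi * I / N) * ∑ a, χ a * a.val := by
  have hdft : ZMod.dft χ = fun k ↦ -gaussSum χ ZMod.stdAddChar * χ⁻¹ k := by
    ext k
    have hinv : χ⁻¹ (-1) = -1 := by
      rw [MulChar.inv_apply_eq_inv', show χ (-1) = -1 from hodd, inv_neg_one]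
    rw [hprim.fourierTransform_eq_inv_mul_gaussSum, ← neg_one_mul k, map_mul, hinv]
    ring
  have h := LFunction_dft_one_of_odd hodd.to_fun
  rw [hdft, LFunction_const_mul] at h
  rw [DirichletCharacter.LFunction]
  linear_combination -h

open scoped ComplexOrder in
theorem LFunction_ofReal_nonneg_of_isQuadratic {N : ℕ} [NeZero N] {χ : DirichletCharacter ℂ N}
    (hχ : χ.IsQuadratic) {s : ℝ} (hs : 1 < s) : 0 ≤ χ.LFunction s := by
  have hre : 1 < (s : ℂ).re := by simpa using hs
  rw [DirichletCharacter.LFunction_eq_LSeries χ hre]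
  refine ge_of_tendsto' (DirichletCharacter.LSeries_eulerProduct χ hre) fun n ↦
    prod_nonneg fun q hq ↦ ?_
  have hq1 : (1 : ℝ) ≤ q := by
    exact_mod_cast (Nat.prime_of_mem_primesBelow hq).one_le
  have hpow : ((q : ℝ) ^ (-s) : ℝ) ≤ 1 := Real.rpow_le_one_of_one_le_of_nonpos hq1 (by linarith)
  have hpow0 : 0 ≤ ((q : ℝ) ^ (-s) : ℝ) := by positivity
  have hcast : (q : ℂ) ^ (-s : ℂ) = ((q : ℝ) ^ (-s) : ℝ) := by
    rw [ofReal_cpow (by positivity)]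
    push_cast
    rfl
  rw [inv_nonneg, hcast]
  rcases hχ q with h | h | h <;> rw [h]
  · simp
  · rw [one_mul]
    exact_mod_cast sub_nonneg.2 hpow
  · rw [neg_one_mul, sub_neg_eq_add]
    exact_mod_cast add_nonneg zero_le_one hpow0

open scoped ComplexOrder in
theorem LFunction_one_pos_of_isQuadratic {N : ℕ} [NeZero N] {χ : DirichletCharacter ℂ N}
    (hχ : χ.IsQuadratic) (hne : χ ≠ 1) : 0 < χ.LFunction 1 := by
  refine lt_of_le_of_ne ?_ (DirichletCharacter.LFunction_apply_one_ne_zero hne).symm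
  have hlim := tendsto_comp_ofReal_nhdsGT (a := 1)
    (DirichletCharacter.differentiable_LFunction hne _).continuousAt
  rw [ofReal_one] at hlim
  exact ge_of_tendsto hlim (eventually_nhdsWithin_of_forall fun s hs ↦
    LFunction_ofReal_nonneg_of_isQuadratic hχ hs)

theorem sum_quadraticChar_mul_val_neg {p : ℕ} [Fact p.Prime] (hp : p % 4 = 3) :
    ∑ a : ZMod p, quadraticChar (ZMod p) a * (a.val : ℤ) < 0 := by
  have hne : quadraticDirichletChar p ≠ 1 := quadraticDirichletChar_ne_one (by grind)
  have hquad := quadraticDirichletChar_isQuadratic p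
  have hL := gaussSum_mul_LFunction_inv_one (isPrimitive_of_prime_of_ne_one hne)
    (quadraticDirichletChar_neg_one hp)
  rw [hquad.inv, gaussSum_quadraticDirichletChar hp] at hL
  obtain ⟨hpos, him⟩ := Complex.pos_iff.1 (LFunction_one_pos_of_isQuadratic hquad hne)
  set L := (quadraticDirichletChar p).LFunction 1
  set A := ∑ a : ZMod p, quadraticChar (ZMod p) a * (a.val : ℤ) with hA
  have hLre : L = (L.re : ℂ) := Complex.ext rfl him.symm
  have hclass : Real.sqrt p * L.re = -(Real.pi / p * A) := by
    refine ofReal_injective (mul_left_cancel₀ I_ne_zero ?_)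
    rw [hLre] at hL
    simp only [quadraticDirichletChar_apply] at hL
    push_cast [hA]
    linear_combination hL
  have hp0 : (0 : ℝ) < p := Nat.cast_pos.2 (NeZero.pos p)
  by_contra! hAnonneg
  have hlhs : 0 < Real.sqrt p * L.re := by positivity
  have hrhs : 0 ≤ Real.pi / p * A := mul_nonneg (by positivity) (Int.cast_nonneg hAnonneg)
  linarith

end LFunctionAtOne

section AlternatingSum

theorem two_mul_val_two_mul {N : ℕ} [NeZero N] (hN : Odd N) (a : ZMod N) :
    2 * ((2 * a).val : ℤ) = 4 * a.val - N * (1 - (-1) ^ (2 * a).val) := by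
  have hlt := a.val_lt
  have hmod : (2 * a).val = 2 * a.val % N := by
    rw [← ZMod.val_natCast, Nat.cast_mul, ZMod.natCast_zmod_val, Nat.cast_ofNat]
  rcases lt_or_ge (2 * a.val) N with hsmall | hlarge
  · rw [hmod, Nat.mod_eq_of_lt hsmall, (even_two_mul a.val).neg_one_pow]
    push_cast
    ring
  · have hval : (2 * a).val = 2 * a.val - N := by
      rw [hmod, Nat.mod_eq_sub_mod hlarge, Nat.mod_eq_of_lt (by lia)]
    have hodd : Odd (2 * a.val - N) := Nat.Even.sub_odd hlarge (even_two_mul _) hN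
    rw [hval, hodd.neg_one_pow, Nat.cast_sub hlarge]
    push_cast
    ring

theorem sum_comp_two_mul {N : ℕ} [NeZero N] (hN : Odd N) {M : Type*} [AddCommMonoid M]
    (f : ZMod N → M) : ∑ a, f (2 * a) = ∑ a, f a := by
  have h2 : IsUnit (2 : ZMod N) := by
    exact_mod_cast (ZMod.isUnit_iff_coprime 2 N).2 (Nat.coprime_two_left.2 hN)
  exact Equiv.sum_comp h2.unit.mulLeft f

theorem natCast_mul_sum_neg_one_pow_val_mul {N : ℕ} [NeZero N] (hN : Odd N)
    {χ : MulChar (ZMod N) ℤ} (hχ : ∑ a, χ a = 0) :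
    N * ∑ a, (-1) ^ a.val * χ a = 2 * (1 - 2 * χ 2) * ∑ a, χ a * (a.val : ℤ) := by
  have hpoint (a : ZMod N) : N * ((-1) ^ (2 * a).val * χ (2 * a)) =
      2 * (χ (2 * a) * ((2 * a).val : ℤ)) - 4 * χ 2 * (χ a * (a.val : ℤ)) +
        N * (χ 2 * χ a) := by
    rw [map_mul]
    linear_combination -(χ 2 * χ a) * two_mul_val_two_mul hN a
  rw [← sum_comp_two_mul hN, mul_sum, sum_congr rfl fun a _ ↦ hpoint a, sum_add_distrib,
    sum_sub_distrib, ← mul_sum, ← mul_sum, ← mul_sum, ← mul_sum, hχ,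
    sum_comp_two_mul hN fun a ↦ χ a * (a.val : ℤ)]
  ring

theorem odd_neg_one_pow_val_mul {N : ℕ} (hN : Odd N) {R : Type*} [CommRing R] {f : ZMod N → R}
    (hf : f.Even) (h0 : f 0 = 0) : Function.Odd fun a ↦ (-1) ^ a.val * f a := by
  intro a
  have : NeZero N := ⟨hN.pos.ne'⟩
  rcases eq_or_ne a 0 with rfl | ha
  · simp [h0]
  have : NeZero a := ⟨ha⟩
  have hsign : (-1 : R) ^ (N - a.val) = -(-1) ^ a.val := by
    rcases a.val.even_or_odd with h | h
    · rw [(Nat.Odd.sub_even a.val_lt.le hN h).neg_one_pow, h.neg_one_pow]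
    · rw [(Nat.Odd.sub_odd hN h).neg_one_pow, h.neg_one_pow, neg_neg]
  simp only [hf a, ZMod.val_neg_of_ne_zero, hsign, neg_mul]

/-- The alternating sum `∑_{0 ≤ a < p} (-1)ᵃ (a/p)` of Legendre symbols, through which both `T(p)`
and the difference between the numbers of even and odd quadratic residues are expressed. -/
def alternatingLegendreSum (p : ℕ) [Fact p.Prime] : ℤ :=
  ∑ a : ZMod p, (-1) ^ a.val * quadraticChar (ZMod p) a

theorem mul_alternatingLegendreSum {p : ℕ} [Fact p.Prime] (hp : Odd p) :
    p * alternatingLegendreSum p = 2 * (1 - 2 * quadraticChar (ZMod p) 2) *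
      ∑ a : ZMod p, quadraticChar (ZMod p) a * (a.val : ℤ) :=
  natCast_mul_sum_neg_one_pow_val_mul hp
    (quadraticChar_sum_zero (ringChar_zmod_ne_two_of_odd hp))

theorem quadraticChar_two_eq_χ₈ {p : ℕ} [Fact p.Prime] (hp : Odd p) :
    quadraticChar (ZMod p) 2 = ZMod.χ₈ (p % 8 : ℕ) := by
  rw [quadraticChar_two (ringChar_zmod_ne_two_of_odd hp), ZMod.card, ZMod.χ₈_nat_mod_eight]

theorem alternatingLegendreSum_neg {p : ℕ} [Fact p.Prime] (hp : p % 8 = 3) :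
    alternatingLegendreSum p < 0 := by
  have hodd : Odd p := by grind
  have hsum := mul_alternatingLegendreSum hodd
  have hneg := sum_quadraticChar_mul_val_neg (p := p) (by lia)
  rw [quadraticChar_two_eq_χ₈ hodd, hp, show ZMod.χ₈ (3 : ℕ) = -1 from rfl] at hsum
  exact neg_of_mul_neg_right (hsum.trans_lt (by linarith)) (Nat.cast_nonneg p)

theorem alternatingLegendreSum_pos {p : ℕ} [Fact p.Prime] (hp : p % 8 = 7) :
    0 < alternatingLegendreSum p := by
  have hodd : Odd p := by grind
  have hsum := mul_alternatingLegendreSum hodd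
  have hneg := sum_quadraticChar_mul_val_neg (p := p) (by lia)
  rw [quadraticChar_two_eq_χ₈ hodd, hp, show ZMod.χ₈ (7 : ℕ) = 1 from rfl] at hsum
  exact pos_of_mul_pos_right (lt_of_lt_of_eq (by linarith) hsum.symm) (Nat.cast_nonneg p)

end AlternatingSum

section Residues

theorem isQuadraticResidue_iff {p : ℕ} [Fact p.Prime] {k : ℕ} :
    IsQuadraticResidue p k ↔ quadraticChar (ZMod p) k = 1 := by
  constructor
  · rintro ⟨hk, hsq⟩
    exact (quadraticChar_one_iff_isSquare hk).2 hsq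
  · intro h
    have hk : (k : ZMod p) ≠ 0 := fun hk ↦ by simp [hk] at h
    exact ⟨hk, (quadraticChar_one_iff_isSquare hk).1 h⟩

theorem ncard_residues {p : ℕ} [Fact p.Prime] (P : ℕ → Prop) [DecidablePred P] :
    {k | k ∈ Set.Icc 1 (p - 1) ∧ P k ∧ IsQuadraticResidue p k}.ncard =
      #{a : ZMod p | P a.val ∧ quadraticChar (ZMod p) a = 1} := by
  have himage : {k | k ∈ Set.Icc 1 (p - 1) ∧ P k ∧ IsQuadraticResidue p k} =
      ZMod.val '' {a : ZMod p | P a.val ∧ quadraticChar (ZMod p) a = 1} := by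
    ext k
    simp only [isQuadraticResidue_iff, Set.mem_ofPred_eq, Set.mem_Icc, Set.mem_image]
    constructor
    · rintro ⟨⟨-, hle⟩, hk⟩
      have hval : (k : ZMod p).val = k :=
        ZMod.val_cast_of_lt (hle.trans_lt (Nat.sub_one_lt (NeZero.ne p)))
      exact ⟨k, by rwa [hval], hval⟩
    · rintro ⟨a, ⟨hP, ha⟩, rfl⟩
      have ha0 : a ≠ 0 := fun h ↦ by simp [h] at ha
      exact ⟨⟨ZMod.val_pos.2 ha0, Nat.le_sub_one_of_lt a.val_lt⟩, hP, by simpa using ha⟩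
  rw [himage, Set.ncard_image_of_injective _ (ZMod.val_injective p), ← Set.ncard_coe_finset]
  simp

theorem two_mul_ncard_evenResidues_sub_ncard_oddResidues {p : ℕ} [Fact p.Prime]
    (hp : p % 4 = 3) :
    2 * ((evenResidues p).ncard - (oddResidues p).ncard : ℤ) = alternatingLegendreSum p := by
  have hsq : ∑ a : ZMod p, (-1) ^ a.val * quadraticChar (ZMod p) a ^ 2 = 0 := by
    refine (odd_neg_one_pow_val_mul (by grind) (fun a ↦ ?_) (by simp)).sum_eq_zero
    rw [← neg_one_mul, map_mul, mul_pow, quadraticChar_sq_one (by simp), one_mul]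
  rw [← add_zero (alternatingLegendreSum p), ← hsq, alternatingLegendreSum, ← sum_add_distrib,
    evenResidues, oddResidues, ncard_residues, ncard_residues, card_filter, card_filter]
  push_cast
  rw [← sum_sub_distrib, mul_sum]
  refine sum_congr rfl fun a _ ↦ ?_
  rcases a.val.even_or_odd with h | h
  · have hnot := Nat.not_odd_iff_even.2 h
    rcases quadraticChar_isQuadratic (ZMod p) a with ha | ha | ha <;>
      simp [ha, h, hnot, h.neg_one_pow]
  · have hnot := Nat.not_even_iff_odd.2 h
    rcases quadraticChar_isQuadratic (ZMod p) a with ha | ha | ha <;>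
      simp [ha, h, hnot, h.neg_one_pow]

end Residues

section TangentSum

theorem sum_zmod_eq_sum_range {N : ℕ} [NeZero N] {M : Type*} [AddCommMonoid M] (f : ZMod N → M) :
    ∑ a, f a = ∑ j ∈ range N, f j :=
  sum_nbij' ZMod.val (↑) (by simp [ZMod.val_lt]) (by simp) (by simp)
    (by simpa using fun j ↦ ZMod.val_cast_of_lt) (by simp)

theorem sum_eq_apply_zero_add_two_nsmul_sum_Icc {m : ℕ} {M : Type*} [AddCommMonoid M]
    {f : ZMod (2 * m + 1) → M} (hf : f.Even) :
    ∑ a, f a = f 0 + 2 • ∑ n ∈ Icc 1 m, f n := by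
  have hreflect : ∑ j ∈ range m, f (m + j + 1 : ℕ) = ∑ j ∈ range m, f (j + 1 : ℕ) := by
    rw [← sum_range_reflect]
    refine sum_congr rfl fun j hj ↦ ?_
    rw [← hf]
    congr 1
    rw [← sub_eq_zero, ← neg_add', neg_eq_zero, ← Nat.cast_add, ZMod.natCast_eq_zero_iff]
    exact dvd_of_eq (by grind)
  have hIcc : ∑ n ∈ Icc 1 m, f n = ∑ j ∈ range m, f (j + 1 : ℕ) := by
    rw [range_eq_Ico, sum_Ico_add' (fun n : ℕ ↦ f n), zero_add]
    rfl
  have hsplit := sum_range_add (fun j ↦ f (j + 1 : ℕ)) m m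
  rw [← two_mul, hreflect, ← hIcc, ← two_nsmul] at hsplit
  rw [sum_zmod_eq_sum_range, sum_range_succ', hsplit, Nat.cast_zero, add_comm]

theorem sum_comp_sq {F : Type*} [Field F] [Fintype F] [DecidableEq F] (hF : ringChar F ≠ 2)
    {R : Type*} [Ring R] (f : F → R) :
    ∑ x, f (x ^ 2) = ∑ a, ((quadraticChar F a : R) + 1) * f a := by
  rw [← sum_fiberwise univ (fun x : F ↦ x ^ 2)]
  refine sum_congr rfl fun a _ ↦ ?_
  have hcard := quadraticChar_card_sqrts hF a
  rw [Set.toFinset_ofPred] at hcard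
  rw [sum_congr rfl fun x hx ↦ congrArg f (mem_filter.1 hx).2, sum_const, nsmul_eq_mul]
  congr 1
  exact_mod_cast congrArg (Int.cast (R := R)) hcard

/-- The function `a ↦ tan (π a / N)` on residue classes modulo `N`, evaluated at the representative
in `{0, …, N - 1}`. -/
noncomputable def zmodTan (N : ℕ) (a : ZMod N) : ℝ :=
  Real.tan (Real.pi * a.val / N)

theorem zmodTan_intCast {N : ℕ} [NeZero N] (k : ℤ) :
    zmodTan N k = Real.tan (Real.pi * k / N) := by
  have hN : (N : ℝ) ≠ 0 := Nat.cast_ne_zero.2 (NeZero.ne N)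
  have hk : (k : ℝ) = (k : ZMod N).val + N * (k / N : ℤ) := by
    exact_mod_cast (ZMod.val_intCast (n := N) k ▸ (Int.emod_add_mul_ediv k N).symm)
  have hshift : Real.pi * k / N = Real.pi * (k : ZMod N).val / N + (k / N : ℤ) * Real.pi := by
    rw [hk]
    field_simp
  rw [hshift, Real.tan_add_int_mul_pi, zmodTan]

theorem zmodTan_neg {N : ℕ} [NeZero N] (a : ZMod N) : zmodTan N (-a) = -zmodTan N a := by
  obtain ⟨k, rfl⟩ := ZMod.intCast_surjective a
  rw [← Int.cast_neg, zmodTan_intCast, zmodTan_intCast, Int.cast_neg, mul_neg, neg_div,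
    Real.tan_neg]

theorem one_sub_I_mul_tan_mul {θ : ℂ} (hθ : 1 + Complex.exp (2 * θ * Complex.I) ≠ 0) :
    (1 - Complex.I * Complex.tan θ) * (1 + Complex.exp (2 * θ * Complex.I)) = 2 := by
  have hcircle := Complex.sin_sq_add_cos_sq θ
  have hexp : Complex.exp (2 * θ * Complex.I) =
      (Complex.cos θ + Complex.sin θ * Complex.I) ^ 2 := by
    rw [← Complex.exp_mul_I, ← Complex.exp_nat_mul]
    ring_nf
  have hfactor : 1 + Complex.exp (2 * θ * Complex.I) =
      2 * Complex.cos θ * (Complex.cos θ + Complex.sin θ * Complex.I) := by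
    rw [hexp]
    linear_combination -hcircle + Complex.sin θ ^ 2 * Complex.I_sq
  have hcos : Complex.cos θ ≠ 0 := fun h ↦ hθ (by rw [hfactor, h]; ring)
  rw [hfactor, Complex.tan_eq_sin_div_cos]
  field_simp
  linear_combination hcircle - Complex.sin θ ^ 2 * Complex.I_sq

theorem sum_neg_one_pow_val_mul_pow_val {N : ℕ} [NeZero N] (hN : Odd N) {R : Type*} [CommRing R]
    {z : R} (hz : z ^ N = 1) : (∑ j : ZMod N, (-1) ^ j.val * z ^ j.val) * (1 + z) = 2 := by
  have hrange : ∑ j : ZMod N, (-1) ^ j.val * z ^ j.val = ∑ i ∈ range N, (-z) ^ i := by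
    rw [sum_zmod_eq_sum_range]
    refine sum_congr rfl fun i hi ↦ ?_
    rw [ZMod.val_cast_of_lt (mem_range.1 hi), neg_pow z]
  have hgeom := geom_sum_mul_neg (-z) N
  rw [hN.neg_pow, hz] at hgeom
  rw [hrange]
  linear_combination hgeom

theorem sum_neg_one_pow_val_mul_stdAddChar {N : ℕ} [NeZero N] (hN : Odd N) (a : ZMod N) :
    ∑ j : ZMod N, (-1) ^ j.val * ZMod.stdAddChar (a * j) = 1 - Complex.I * zmodTan N a := by
  set z := ZMod.stdAddChar a with hz
  have hpow (j : ZMod N) : ZMod.stdAddChar (a * j) = z ^ j.val := by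
    rw [← AddChar.map_nsmul_eq_pow, nsmul_eq_mul, ZMod.natCast_zmod_val, mul_comm]
  have hexp : z = Complex.exp (2 * (Real.pi * a.val / N : ℝ) * Complex.I) := by
    rw [hz, ← ZMod.natCast_zmod_val a, ← Int.cast_natCast, ZMod.stdAddChar_coe]
    congr 1
    push_cast [ZMod.natCast_zmod_val]
    ring
  have hgeom := sum_neg_one_pow_val_mul_pow_val hN (z := z)
    (by simp [hz, ← AddChar.map_nsmul_eq_pow])
  have hz1 : 1 + z ≠ 0 := right_ne_zero_of_mul (hgeom.trans_ne two_ne_zero)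
  refine mul_right_cancel₀ hz1 ?_
  simp_rw [hpow]
  rw [hgeom, zmodTan, Complex.ofReal_tan, hexp, one_sub_I_mul_tan_mul (hexp ▸ hz1)]

theorem sum_quadraticChar_mul_zmodTan {p : ℕ} [Fact p.Prime] (hp : p % 4 = 3) :
    ∑ a, quadraticChar (ZMod p) a * zmodTan p a = -(Real.sqrt p * alternatingLegendreSum p) := by
  have hodd : Odd p := by grind
  set χ := quadraticDirichletChar p with hχ
  have hsum : ∑ a, χ a = 0 :=
    MulChar.sum_eq_zero_of_ne_one (quadraticDirichletChar_ne_one hodd)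
  have hgauss (j : ZMod p) : ∑ a, χ a * ZMod.stdAddChar (a * j) =
      χ j * (Complex.I * Real.sqrt p) := by
    rw [hχ, ← gaussSum_quadraticDirichletChar hp, ← sum_quadraticDirichletChar_mul_stdAddChar hodd]
    simp_rw [mul_comm j]
  have hswap : ∑ a, χ a * (1 - Complex.I * zmodTan p a) =
      Complex.I * Real.sqrt p * ∑ j : ZMod p, (-1) ^ j.val * χ j := by
    simp_rw [← sum_neg_one_pow_val_mul_stdAddChar hodd, mul_sum]
    rw [sum_comm]
    refine sum_congr rfl fun j _ ↦ ?_
    simp_rw [mul_left_comm, ← mul_sum, hgauss]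
    ring
  have hsplit : ∑ a, χ a * (1 - Complex.I * zmodTan p a) =
      -(Complex.I * ∑ a, χ a * zmodTan p a) := by
    simp_rw [mul_sub, mul_one, sum_sub_distrib, hsum, zero_sub, mul_left_comm _ Complex.I,
      ← mul_sum]
  refine Complex.ofReal_injective (mul_left_cancel₀ Complex.I_ne_zero ?_)
  rw [hsplit] at hswap
  simp only [hχ, quadraticDirichletChar_apply] at hswap
  rw [alternatingLegendreSum]
  push_cast
  linear_combination -hswap

theorem two_mul_tanSum {p : ℕ} [Fact p.Prime] (hp : p % 4 = 3) :
    2 * tanSum p = -(p * alternatingLegendreSum p) := by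
  obtain ⟨m, rfl⟩ : Odd p := by grind
  set N := 2 * m + 1
  have hodd : Odd N := ⟨m, rfl⟩
  have htan (n : ℕ) : zmodTan N ((n : ZMod N) ^ 2) = Real.tan (Real.pi * (n : ℝ) ^ 2 / N) := by
    have := zmodTan_intCast (N := N) (n ^ 2)
    push_cast at this
    exact this
  have htanSum : tanSum N = Real.sqrt N * ∑ n ∈ Icc 1 m, zmodTan N ((n : ZMod N) ^ 2) := by
    rw [tanSum, show (N - 1) / 2 = m by lia]
    simp_rw [htan]
  have hsquares := sum_comp_sq (ringChar_zmod_ne_two_of_odd hodd) (zmodTan N)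
  have hzero : ∑ a, zmodTan N a = 0 := Function.Odd.sum_eq_zero zmodTan_neg
  rw [sum_eq_apply_zero_add_two_nsmul_sum_Icc fun x ↦ by rw [neg_sq]] at hsquares
  simp_rw [add_mul, one_mul, sum_add_distrib] at hsquares
  rw [hzero, sum_quadraticChar_mul_zmodTan hp] at hsquares
  have htan0 : zmodTan N (0 ^ 2) = 0 := by simp [zmodTan]
  rw [htan0, zero_add, add_zero, nsmul_eq_mul, Nat.cast_ofNat] at hsquares
  rw [htanSum]
  linear_combination Real.sqrt N * hsquares -
    (alternatingLegendreSum N : ℝ) * Real.mul_self_sqrt N.cast_nonneg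

end TangentSum

theorem mainTheorem3 (p : ℕ) (hp : p.Prime) :
    (p ≡ 3 [MOD 8] → 0 < tanSum p ∧ (evenResidues p).ncard < (oddResidues p).ncard) ∧
    (p ≡ 7 [MOD 8] → tanSum p < 0 ∧ (oddResidues p).ncard < (evenResidues p).ncard) := by
  have : Fact p.Prime := ⟨hp⟩
  have hp0 : (0 : ℝ) < p := Nat.cast_pos.2 hp.pos
  refine ⟨fun (h3 : p % 8 = 3) ↦ ?_, fun (h7 : p % 8 = 7) ↦ ?_⟩
  · have hmod : p % 4 = 3 := by lia
    have hneg := alternatingLegendreSum_neg h3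
    have hcount := two_mul_ncard_evenResidues_sub_ncard_oddResidues hmod
    have hprod := mul_neg_of_pos_of_neg hp0 (Int.cast_lt_zero.2 hneg)
    exact ⟨by linarith [two_mul_tanSum hmod], by lia⟩
  · have hmod : p % 4 = 3 := by lia
    have hpos := alternatingLegendreSum_pos h7
    have hcount := two_mul_ncard_evenResidues_sub_ncard_oddResidues hmod
    have hprod := mul_pos hp0 (Int.cast_pos.2 hpos)
    exact ⟨by linarith [two_mul_tanSum hmod], by lia⟩
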